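/- Let $\mathcal H\cong\mathbb C^n$ be a finite-dimensional Hilbert space and let $\Phi:\mathcal L(\mathcal H)\to\mathcal L(\mathcal H)$ be a channel (a completely positive, trace-preserving linear map). Let $\Phi^C:\mathcal L(\mathcal H)\to\mathcal L(\mathcal H_C)$ be a complementary map: there is an isometry $V:\mathcal H\to\mathcal H\otimes\mathcal H_C$, with $\mathcal H_C$ finite-dimensional, such that $\Phi(\rho)=\mathrm{tr}_{\mathcal H_C}(V\rho V^*)$ and $\Phi^C(\rho)=\mathrm{tr}_{\mathcal H}(V\rho V^*)$ for all $\rho$. The dual $\Psi^\dagger$ of a linear map $\Psi$ is defined by $\mathrm{tr}(\Psi(\rho)X)=\mathrm{tr}(\rho\,\Psi^\dagger(X))$, a prime denotes the commutant in $\mathcal L(\mathcal H)$, and $S^\perp$ denotes the orthogonal complement in $\mathcal L(\mathcal H)$ for the trace inner product $\langle X,Y\rangle=\mathrm{tr}(X^*Y)$. Let $\mathcal A\subseteq\mathcal L(\mathcal H)$ be a von Neumann subalgebra (a $*$-subalgebra containing $I$). It is correctable for $\Phi$ if there is a channel $\mathcal R:\mathcal L(\mathcal H)\to\mathcal A$ with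 $\Phi^\dagger\circ\mathcal R^\dagger=\mathrm{id}_{\mathcal A}$, and private for $\Phi^C$ if $(\Phi^C)^\dagger(\mathcal L(\mathcal H_C))\subseteq\mathcal A'$. For a representation $\pi:\mathcal A\to\mathcal L(\mathcal H)$ (linear, multiplicative, $*$-preserving, not necessarily unital), the generalized multiplicative domain is $$\mathcal M_\pi(\Phi)=\{A\in\mathcal A:\ \Phi(AX)=\pi(A)\Phi(X),\ \Phi(XA)=\Phi(X)\pi(A)\ \text{ for all } X\in\mathcal L(\mathcal H)\},$$ and $\pi$ is said to be associated with the correctable algebra $\mathcal A$ if $\mathcal A=\mathcal M_\pi(\Phi)$. Then: 1. A von Neumann subalgebra of $\mathcal L(\mathcal H)$ is correctable for $\Phi$ if and only if it is private for $\Phi^C$. 2. If $\pi$ is a representation associated with a correctable algebra $\mathcal A$ for $\Phi$ (equivalently, a private algebra for $\Phi^C$), then $\mathcal M_\pi(\Phi)\subseteq\big((\ker\Phi^C)^\perp\big)'$, and $$\mathcal M_\pi(\Phi)=\big((\ker\Phi^C)^\perp\big)'$$ holds if and only if $\mathcal A$ is maximal, with respect to inclusion, among the correctable algebras for $\Phi$.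 3. There are a correctable algebra $\mathcal N$ for $\Phi$ containing every correctable algebra for $\Phi$, and a representation $\varpi:\mathcal N\to\mathcal L(\mathcal H)$ associated with $\mathcal N$, so that $\mathcal M_\varpi(\Phi)=\big((\ker\Phi^C)^\perp\big)'$; moreover, for every correctable algebra $\mathcal A$ for $\Phi$, the restriction of $\varpi$ to $\mathcal A$ is associated with $\mathcal A$. -/

import Mathlib

open scoped Matrix Matrix.Norms.L2Operator MatrixOrder

namespace QChannel

/-- Quantum channels: completely positive trace-preserving linear maps
`L(ℂⁿ) → L(ℂᵐ)`. -/
structure IsChannel {n m : Type*} [Fintype n] [DecidableEq n] [Fintype m] [DecidableEq m]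
    (Φ : Matrix n n ℂ →ₗ[ℂ] Matrix m m ℂ) : Prop where
  completelyPositive : ∃ φ : CompletelyPositiveMap (Matrix n n ℂ) (Matrix m m ℂ),
    ∀ X, φ X = Φ X
  tracePreserving : ∀ X, (Φ X).trace = X.trace

/-- The dual map `Φ†` for the trace form: `tr (Φ(ρ) X) = tr (ρ Φ†(X))`;
see `trace_mul_traceDual`. -/
noncomputable def traceDual {n m : Type*} [Fintype n] [DecidableEq n] [Fintype m]
    (Φ : Matrix n n ℂ →ₗ[ℂ] Matrix m m ℂ) : Matrix m m ℂ →ₗ[ℂ] Matrix n n ℂ where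
  toFun X := Matrix.of fun i j => (Φ (Matrix.single j i 1) * X).trace
  map_add' X Y := by
    ext i j
    simp [Matrix.mul_add]
  map_smul' a X := by
    ext i j
    simp

theorem trace_mul_traceDual {n m : Type*} [Fintype n] [DecidableEq n] [Fintype m]
    (Φ : Matrix n n ℂ →ₗ[ℂ] Matrix m m ℂ) (ρ : Matrix n n ℂ) (X : Matrix m m ℂ) :
    (Φ ρ * X).trace = (ρ * traceDual Φ X).trace := by
  have key : (Matrix.traceLinearMap m ℂ ℂ ∘ₗ LinearMap.mulRight ℂ X) ∘ₗ Φ =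
      Matrix.traceLinearMap n ℂ ℂ ∘ₗ LinearMap.mulRight ℂ (traceDual Φ X) := by
    refine Matrix.ext_linearMap ℂ fun i j => LinearMap.ext_ring ?_
    simp [traceDual, Matrix.trace_single_mul]
  exact LinearMap.congr_fun key ρ

/-- Partial trace of `L(ℂⁿ ⊗ ℂᶜ)` over the factor `ℂᶜ`. -/
def partialTraceEnv {n c : Type*} [Fintype c] (T : Matrix (n × c) (n × c) ℂ) : Matrix n n ℂ :=
  Matrix.of fun i j => ∑ k, T (i, k) (j, k)

/-- Partial trace of `L(ℂⁿ ⊗ ℂᶜ)` over the factor `ℂⁿ`. -/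
def partialTraceSys {n c : Type*} [Fintype n] (T : Matrix (n × c) (n × c) ℂ) : Matrix c c ℂ :=
  Matrix.of fun k l => ∑ i, T (i, k) (i, l)

/-- `ΦC` is a complementary map of `Φ`: for some isometry `V : ℂⁿ → ℂⁿ ⊗ ℂᶜ`, the maps `Φ` and
`ΦC` are the two partial traces of `ρ ↦ V ρ V*`. -/
def IsComplementary {n c : Type*} [Fintype n] [DecidableEq n] [Fintype c]
    (Φ : Matrix n n ℂ →ₗ[ℂ] Matrix n n ℂ) (ΦC : Matrix n n ℂ →ₗ[ℂ] Matrix c c ℂ) : Prop :=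
  ∃ V : Matrix (n × c) n ℂ, Vᴴ * V = 1 ∧
    (∀ ρ, Φ ρ = partialTraceEnv (V * ρ * Vᴴ)) ∧
    (∀ ρ, ΦC ρ = partialTraceSys (V * ρ * Vᴴ))

/-- A von Neumann subalgebra `𝒜` of `L(ℂⁿ)` is correctable for `Φ` if some channel `R` with
values in `𝒜` satisfies `Φ† ∘ R† = id` on `𝒜`. -/
def IsCorrectable {n : Type*} [Fintype n] [DecidableEq n]
    (Φ : Matrix n n ℂ →ₗ[ℂ] Matrix n n ℂ) (𝒜 : StarSubalgebra ℂ (Matrix n n ℂ)) : Prop :=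
  ∃ R : Matrix n n ℂ →ₗ[ℂ] Matrix n n ℂ, IsChannel R ∧ (∀ Y, R Y ∈ 𝒜) ∧
    ∀ A ∈ 𝒜, traceDual Φ (traceDual R A) = A

/-- A von Neumann subalgebra `𝒜` of `L(ℂⁿ)` is private for `Ψ` if the range of `Ψ†` lies in the
commutant of `𝒜`. -/
def IsPrivate {n m : Type*} [Fintype n] [DecidableEq n] [Fintype m]
    (Ψ : Matrix n n ℂ →ₗ[ℂ] Matrix m m ℂ) (𝒜 : StarSubalgebra ℂ (Matrix n n ℂ)) : Prop :=
  ∀ Y, traceDual Ψ Y ∈ Set.centralizer (𝒜 : Set (Matrix n n ℂ))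

/-- The generalized multiplicative domain `M_π(Φ)` of a representation `π` of `𝒜`. -/
def genMultDomain {n : Type*} [Fintype n] [DecidableEq n]
    (Φ : Matrix n n ℂ →ₗ[ℂ] Matrix n n ℂ) (𝒜 : StarSubalgebra ℂ (Matrix n n ℂ))
    (π : 𝒜 →⋆ₙₐ[ℂ] Matrix n n ℂ) : Set (Matrix n n ℂ) :=
  {A | ∃ hA : A ∈ 𝒜, ∀ X, Φ (A * X) = π ⟨A, hA⟩ * Φ X ∧ Φ (X * A) = Φ X * π ⟨A, hA⟩}

/-- The representation `π` of `𝒜` is associated with `𝒜` as an algebra correctable for `Φ`: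
`𝒜 = M_π(Φ)`. -/
def IsAssociated {n : Type*} [Fintype n] [DecidableEq n]
    (Φ : Matrix n n ℂ →ₗ[ℂ] Matrix n n ℂ) (𝒜 : StarSubalgebra ℂ (Matrix n n ℂ))
    (π : 𝒜 →⋆ₙₐ[ℂ] Matrix n n ℂ) : Prop :=
  (𝒜 : Set (Matrix n n ℂ)) = genMultDomain Φ 𝒜 π

/-- Orthogonal complement for the trace inner product `⟨X, Y⟩ = tr (X* Y)`. -/
def tracePerp {n : Type*} [Fintype n] (S : Submodule ℂ (Matrix n n ℂ)) :
    Submodule ℂ (Matrix n n ℂ) where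
  carrier := {Y | ∀ X ∈ S, (Xᴴ * Y).trace = 0}
  add_mem' := by
    intro a b ha hb X hX
    simp [Matrix.mul_add, ha X hX, hb X hX]
  zero_mem' := by
    intro X _
    simp
  smul_mem' := by
    intro a Y hY X hX
    simp [hY X hX]

/-- The commutant of the trace-orthogonal complement of the null space, `((ker Ψ)^⊥)′`. -/
def kerPerpCommutant {n m : Type*} [Fintype n]
    (Ψ : Matrix n n ℂ →ₗ[ℂ] Matrix m m ℂ) : Set (Matrix n n ℂ) :=
  Set.centralizer (tracePerp (LinearMap.ker Ψ) : Set (Matrix n n ℂ))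

end QChannel

/-! Slicing `V` along the environment gives Kraus operators `Kₖ` with `Φ X = ∑ Kₖ X Kₖ*` and `(ΦC
X)ₖₗ = tr (Kₖ X Kₗ*)`. Both the range of `ΦC†` and `(ker ΦC)^⊥` are then the span of the `Kₖ* Kₗ`,
and every claim reduces to one fact: `𝒜` is correctable iff it commutes with all `Kₖ* Kₗ`, i.e. `𝒜 ≤
krausCommutant K`. So `krausCommutant K` is the largest correctable algebra.

If `R` corrects `𝒜`, put `B = R†(A)`. The Kadison–Schwarz inequality for `R†` forces `∑ ‖B Kₖ - Kₖ
A‖² ≤ 0` in the Hilbert–Schmidt norm, so `B Kₖ = Kₖ A`, and `Kₖ* B Kₗ` evaluated in two ways gives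
the commutation (`le_krausCommutant_of_isCorrectable`).

Conversely, with `Q` the pseudo-inverse square root of `Φ(1)`, `π(A) = Q Φ(A) Q` is a representation
of the commutant with `π(A) Kₖ = Kₖ A` (`exists_representation`). A Petz-type recovery map built
from `Q`, followed by the conditional expectation onto `𝒜`, corrects `𝒜`
(`isCorrectable_of_le_krausCommutant`). The same `π` serves as `ϖ`. -/

namespace QChannel

/-! ### Negative parts in closed `*`-subalgebras -/

section CStarAlgebra

variable {A : Type*} [NonUnitalCStarAlgebra A] [PartialOrder A] [StarOrderedRing A]

theorem exists_eq_star_mul_self_of_nonneg {a : A} (ha : 0 ≤ a) : ∃ b, a = star b * b :=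
  CStarAlgebra.nonneg_iff_eq_star_mul_self.1 ha

/-- The witness is `a⁻`: it lies in `S` by functional calculus, and `a⁺ a⁻ = 0`. It lets positivity
be tested against elements of `S` alone. -/
theorem exists_negPart_mem {S : NonUnitalStarSubalgebra ℂ A} (hS : IsClosed (S : Set A)) {a : A}
    (haS : a ∈ S) (ha : IsSelfAdjoint a) :
    ∃ b ∈ S, 0 ≤ b ∧ a * b = -(star b * b) ∧ (b = 0 → 0 ≤ a) := by
  refine ⟨a⁻, cfcₙ_mem (𝕜' := ℂ) _ haS, CFC.negPart_nonneg a, ?_, fun h => ?_⟩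
  · rw [(IsSelfAdjoint.of_nonneg (CFC.negPart_nonneg a)).star_eq]
    nth_rw 1 [← CFC.posPart_sub_negPart a ha]
    rw [sub_mul, CFC.posPart_mul_negPart, zero_sub]
  · exact (CFC.negPart_eq_zero_iff a ha).1 h

end CStarAlgebra

/-! ### Completely positive maps and the block trace -/

section CompletePositivity

open scoped ComplexOrder

variable {n : Type*} [Fintype n]

theorem trace_conjTranspose_mul_self_nonneg (A : Matrix n n ℂ) : 0 ≤ (Aᴴ * A).trace :=
  (Matrix.posSemidef_conjTranspose_mul_self A).trace_nonneg

/-- The trace on matrices with matrix entries. -/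
noncomputable def blockTrace {k : ℕ} (M : CStarMatrix (Fin k) (Fin k) (Matrix n n ℂ)) : ℂ :=
  ∑ i, (M i i).trace

theorem blockTrace_mul {k : ℕ} (M N : CStarMatrix (Fin k) (Fin k) (Matrix n n ℂ)) :
    blockTrace (M * N) = ∑ i, ∑ j, (M i j * N j i).trace := by
  simp [blockTrace, CStarMatrix.mul_apply, Matrix.trace_sum]

theorem blockTrace_mul_comm {k : ℕ} (M N : CStarMatrix (Fin k) (Fin k) (Matrix n n ℂ)) :
    blockTrace (M * N) = blockTrace (N * M) := by
  rw [blockTrace_mul, blockTrace_mul, Finset.sum_comm]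
  exact Finset.sum_congr rfl fun i _ => Finset.sum_congr rfl fun j _ => Matrix.trace_mul_comm _ _

theorem blockTrace_star_mul_self {k : ℕ} (M : CStarMatrix (Fin k) (Fin k) (Matrix n n ℂ)) :
    blockTrace (star M * M) = ∑ i, ∑ j, ((M j i)ᴴ * M j i).trace := by
  simp [blockTrace_mul, CStarMatrix.star_apply, Matrix.star_eq_conjTranspose]

theorem blockTrace_star_mul_self_nonneg {k : ℕ}
    (M : CStarMatrix (Fin k) (Fin k) (Matrix n n ℂ)) : 0 ≤ blockTrace (star M * M) := by
  rw [blockTrace_star_mul_self]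
  exact Finset.sum_nonneg fun i _ => Finset.sum_nonneg fun j _ =>
    trace_conjTranspose_mul_self_nonneg _

theorem eq_zero_of_blockTrace_star_mul_self {k : ℕ}
    {M : CStarMatrix (Fin k) (Fin k) (Matrix n n ℂ)} (h : blockTrace (star M * M) = 0) :
    M = 0 := by
  rw [blockTrace_star_mul_self, Finset.sum_eq_zero_iff_of_nonneg fun i _ =>
    Finset.sum_nonneg fun j _ => trace_conjTranspose_mul_self_nonneg _] at h
  ext1 i j
  have := h j (Finset.mem_univ _)
  rw [Finset.sum_eq_zero_iff_of_nonneg fun j _ => trace_conjTranspose_mul_self_nonneg _] at this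
  exact Matrix.trace_conjTranspose_mul_self_eq_zero_iff.1 (this i (Finset.mem_univ _))

variable [DecidableEq n]

/-- Complete positivity of a linear map between matrix algebras, as a predicate. -/
def IsCP (Φ : Matrix n n ℂ →ₗ[ℂ] Matrix n n ℂ) : Prop :=
  ∀ (k : ℕ) (M : CStarMatrix (Fin k) (Fin k) (Matrix n n ℂ)), 0 ≤ M → 0 ≤ M.map Φ

theorem IsCP.isChannel {Φ : Matrix n n ℂ →ₗ[ℂ] Matrix n n ℂ} (h : IsCP Φ)
    (htr : ∀ X, (Φ X).trace = X.trace) : IsChannel Φ :=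
  ⟨⟨⟨Φ, h⟩, fun _ => rfl⟩, htr⟩

theorem IsChannel.isCP {Φ : Matrix n n ℂ →ₗ[ℂ] Matrix n n ℂ} (h : IsChannel Φ) : IsCP Φ := by
  obtain ⟨φ, hφ⟩ := h.completelyPositive
  intro k M hM
  have : M.map Φ = M.map φ := by
    ext1 i j
    simp [hφ]
  rw [this]
  exact φ.map_cstarMatrix_nonneg M hM

theorem IsChannel.map_conjTranspose {Φ : Matrix n n ℂ →ₗ[ℂ] Matrix n n ℂ} (h : IsChannel Φ)
    (X : Matrix n n ℂ) : Φ Xᴴ = (Φ X)ᴴ := by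
  obtain ⟨φ, hφ⟩ := h.completelyPositive
  rw [← hφ, ← hφ]
  exact map_star φ X

theorem IsCP.add {Φ Ψ : Matrix n n ℂ →ₗ[ℂ] Matrix n n ℂ} (hΦ : IsCP Φ) (hΨ : IsCP Ψ) :
    IsCP (Φ + Ψ) := fun k M hM => by
  have : M.map (Φ + Ψ) = M.map Φ + M.map Ψ := by
    ext1 i j
    simp
  rw [this]
  exact add_nonneg (hΦ k M hM) (hΨ k M hM)

theorem isCP_zero : IsCP (0 : Matrix n n ℂ →ₗ[ℂ] Matrix n n ℂ) := fun k M _ => by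
  have : M.map (0 : Matrix n n ℂ →ₗ[ℂ] Matrix n n ℂ) = 0 := by
    ext1 i j
    simp
  rw [this]

theorem IsCP.sum {ι : Type*} (s : Finset ι) {Φ : ι → Matrix n n ℂ →ₗ[ℂ] Matrix n n ℂ}
    (h : ∀ i, IsCP (Φ i)) : IsCP (∑ i ∈ s, Φ i) :=
  Finset.sum_induction Φ IsCP (fun _ _ => IsCP.add) isCP_zero fun i _ => h i

theorem IsCP.comp {Φ Ψ : Matrix n n ℂ →ₗ[ℂ] Matrix n n ℂ} (hΦ : IsCP Φ) (hΨ : IsCP Ψ) :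
    IsCP (Φ ∘ₗ Ψ) := fun k M hM => hΦ k _ (hΨ k M hM)

/-- The map `X ↦ K X K*`. -/
noncomputable def conjMap (K : Matrix n n ℂ) : Matrix n n ℂ →ₗ[ℂ] Matrix n n ℂ :=
  LinearMap.mulLeft ℂ K ∘ₗ LinearMap.mulRight ℂ Kᴴ

@[simp]
theorem conjMap_apply (K X : Matrix n n ℂ) : conjMap K X = K * X * Kᴴ := by
  simp [conjMap, mul_assoc]

theorem isCP_conjMap (K : Matrix n n ℂ) : IsCP (conjMap K) := fun k M hM => by
  -- Applying `K · K*` entrywise is conjugation by the block diagonal matrix with entries `K`.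
  let D : CStarMatrix (Fin k) (Fin k) (Matrix n n ℂ) :=
    CStarMatrix.ofMatrix (Matrix.diagonal fun _ => K)
  have : M.map (conjMap K) = D * M * star D := by
    ext1 i j
    simp [D, CStarMatrix.mul_apply, CStarMatrix.star_apply, Matrix.diagonal_apply,
      Matrix.star_eq_conjTranspose, apply_ite Matrix.conjTranspose]
  rw [this]
  exact star_right_conjugate_nonneg hM D

/-- With `M = C* C` and `N = D* D`, cyclicity turns the trace into that of `(C D*)* (C D*)`. -/
theorem blockTrace_mul_nonneg {k : ℕ} {M N : CStarMatrix (Fin k) (Fin k) (Matrix n n ℂ)}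
    (hM : 0 ≤ M) (hN : 0 ≤ N) : 0 ≤ blockTrace (M * N) := by
  obtain ⟨C, rfl⟩ := exists_eq_star_mul_self_of_nonneg hM
  obtain ⟨D, rfl⟩ := exists_eq_star_mul_self_of_nonneg hN
  have : blockTrace (star C * C * (star D * D)) =
      blockTrace (star (C * star D) * (C * star D)) := by
    rw [← mul_assoc, blockTrace_mul_comm]
    simp [mul_assoc]
  rw [this]
  exact blockTrace_star_mul_self_nonneg _

/-- The map `X ↦ (n⁻¹ tr X) I`. -/
noncomputable def depolarizing (n : Type*) [Fintype n] [DecidableEq n] :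
    Matrix n n ℂ →ₗ[ℂ] Matrix n n ℂ :=
  ∑ i : n, ∑ j : n,
    conjMap (((Real.sqrt (Fintype.card n))⁻¹ : ℂ) • Matrix.single i j 1)

theorem depolarizing_apply (X : Matrix n n ℂ) :
    depolarizing n X = ((Fintype.card n : ℂ)⁻¹ * X.trace) • 1 := by
  have h : ((Real.sqrt (Fintype.card n))⁻¹ : ℂ) * ((Real.sqrt (Fintype.card n))⁻¹ : ℂ) =
      (Fintype.card n : ℂ)⁻¹ := by
    rw [← mul_inv, ← Complex.ofReal_mul, Real.mul_self_sqrt (by positivity)]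
    simp
  have h1 (i j : n) : conjMap (((Real.sqrt (Fintype.card n))⁻¹ : ℂ) • Matrix.single i j 1) X =
      Matrix.single i i ((Fintype.card n : ℂ)⁻¹ * X j j) := by
    rw [← h]
    simp [mul_comm, mul_left_comm]
  have h2 : depolarizing n X = ∑ i : n, ∑ j : n,
      Matrix.single i i ((Fintype.card n : ℂ)⁻¹ * X j j) := by
    simp only [depolarizing, LinearMap.sum_apply, h1]
  ext a b
  rw [h2]
  by_cases hab : a = b
  · subst hab
    simp [Matrix.sum_apply, Matrix.single_apply, Matrix.trace, Finset.mul_sum]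
  · have (i : n) : ¬(i = a ∧ i = b) := fun h => hab (h.1.symm.trans h.2)
    simp [Matrix.sum_apply, this, hab]

theorem isCP_depolarizing : IsCP (depolarizing n) :=
  IsCP.sum _ fun _ => IsCP.sum _ fun _ => isCP_conjMap _

theorem trace_depolarizing (X : Matrix n n ℂ) : (depolarizing n X).trace = X.trace := by
  rcases isEmpty_or_nonempty n with h | h
  · simp [Matrix.trace]
  · rw [depolarizing_apply]
    simp [Matrix.trace_smul]
    field_simp

end CompletePositivity

/-! ### The conditional expectation onto a `*`-subalgebra -/

section ConditionalExpectation

open scoped ComplexOrder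

variable {n : Type*} [Fintype n] [DecidableEq n]

/-- Test against `(A - B)*`. With `𝒜 = ⊤` this is nondegeneracy of the trace form, used below to
identify dual maps. -/
theorem eq_of_trace_mul_eq (𝒜 : StarSubalgebra ℂ (Matrix n n ℂ)) {A B : Matrix n n ℂ}
    (hA : A ∈ 𝒜) (hB : B ∈ 𝒜) (h : ∀ C ∈ 𝒜, (A * C).trace = (B * C).trace) : A = B := by
  rw [← sub_eq_zero, ← Matrix.trace_mul_conjTranspose_self_eq_zero_iff]
  have := h _ (star_mem (sub_mem hA hB))
  rw [Matrix.star_eq_conjTranspose] at this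
  rw [sub_mul, Matrix.trace_sub, this, sub_self]

/-- The trace form embeds `𝒜` in its dual, onto by dimension; `E X` represents the functional `A ↦
tr (X A)`. -/
theorem exists_condExp (𝒜 : StarSubalgebra ℂ (Matrix n n ℂ)) :
    ∃ E : Matrix n n ℂ →ₗ[ℂ] Matrix n n ℂ, (∀ X, E X ∈ 𝒜) ∧
      ∀ X, ∀ A ∈ 𝒜, (E X * A).trace = (X * A).trace := by
  let W : Submodule ℂ (Matrix n n ℂ) := Subalgebra.toSubmodule 𝒜.toSubalgebra
  let T : Matrix n n ℂ →ₗ[ℂ] Module.Dual ℂ W :=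
    (LinearMap.lcomp ℂ ℂ W.subtype) ∘ₗ (LinearMap.compRight ℂ (Matrix.traceLinearMap n ℂ ℂ)) ∘ₗ
      LinearMap.mul ℂ (Matrix n n ℂ)
  have hT (X : Matrix n n ℂ) (A : W) : T X A = (X * A.1).trace := rfl
  have hinj : Function.Injective (T ∘ₗ W.subtype) := fun A B h => by
    refine Subtype.ext (eq_of_trace_mul_eq 𝒜 A.2 B.2 fun C hC => ?_)
    exact LinearMap.congr_fun h ⟨C, hC⟩
  let e := LinearEquiv.ofInjectiveOfFinrankEq _ hinj (Subspace.dual_finrank_eq).symm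
  refine ⟨W.subtype ∘ₗ e.symm.toLinearMap ∘ₗ T, fun X => (e.symm (T X)).2, fun X A hA => ?_⟩
  have : e (e.symm (T X)) = T X := e.apply_symm_apply _
  exact LinearMap.congr_fun this ⟨A, hA⟩

/-- The trace-preserving conditional expectation onto a `*`-subalgebra of `L(ℂⁿ)`. -/
noncomputable def condExp (𝒜 : StarSubalgebra ℂ (Matrix n n ℂ)) :
    Matrix n n ℂ →ₗ[ℂ] Matrix n n ℂ :=
  (exists_condExp 𝒜).choose

variable (𝒜 : StarSubalgebra ℂ (Matrix n n ℂ))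

theorem condExp_mem (X : Matrix n n ℂ) : condExp 𝒜 X ∈ 𝒜 := (exists_condExp 𝒜).choose_spec.1 X

variable {𝒜} in
theorem trace_condExp_mul (X : Matrix n n ℂ) {A : Matrix n n ℂ} (hA : A ∈ 𝒜) :
    (condExp 𝒜 X * A).trace = (X * A).trace :=
  (exists_condExp 𝒜).choose_spec.2 X A hA

theorem trace_condExp (X : Matrix n n ℂ) : (condExp 𝒜 X).trace = X.trace := by
  simpa using trace_condExp_mul X (one_mem 𝒜)

theorem condExp_conjTranspose (X : Matrix n n ℂ) : condExp 𝒜 Xᴴ = (condExp 𝒜 X)ᴴ := by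
  refine eq_of_trace_mul_eq 𝒜 (condExp_mem 𝒜 _) (star_mem (condExp_mem 𝒜 X)) fun C hC => ?_
  have h := trace_condExp_mul X (star_mem hC)
  rw [Matrix.star_eq_conjTranspose] at h
  rw [trace_condExp_mul _ hC, ← star_inj, ← Matrix.trace_conjTranspose, ← Matrix.trace_conjTranspose,
    Matrix.conjTranspose_mul, Matrix.conjTranspose_mul, Matrix.conjTranspose_conjTranspose,
    Matrix.conjTranspose_conjTranspose, Matrix.trace_mul_comm, ← h, Matrix.trace_mul_comm]

/-- Block matrices with entries in a given `*`-subalgebra. -/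
def blockSubalgebra (k : ℕ) :
    NonUnitalStarSubalgebra ℂ (CStarMatrix (Fin k) (Fin k) (Matrix n n ℂ)) where
  carrier := {M | ∀ i j, M i j ∈ 𝒜}
  add_mem' hM hN i j := add_mem (hM i j) (hN i j)
  zero_mem' _ _ := zero_mem 𝒜
  mul_mem' hM hN i j := by
    rw [CStarMatrix.mul_apply]
    exact sum_mem fun l _ => mul_mem (hM i l) (hN l j)
  smul_mem' a M hM i j := 𝒜.smul_mem (hM i j) a
  star_mem' hM i j := star_mem (hM j i)

theorem isClosed_blockSubalgebra (k : ℕ) :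
    IsClosed (blockSubalgebra 𝒜 k : Set (CStarMatrix (Fin k) (Fin k) (Matrix n n ℂ))) := by
  have h : IsClosed (𝒜 : Set (Matrix n n ℂ)) :=
    (Subalgebra.toSubmodule 𝒜.toSubalgebra).closed_of_finiteDimensional
  have : (blockSubalgebra 𝒜 k : Set (CStarMatrix (Fin k) (Fin k) (Matrix n n ℂ))) =
      ⋂ i, ⋂ j, {M | M i j ∈ 𝒜} := by
    ext M
    simp only [Set.mem_iInter]
    rfl
  rw [this]
  refine isClosed_iInter fun i => isClosed_iInter fun j => h.preimage ?_
  exact (continuous_apply j).comp (continuous_apply i)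

/-- The negative part `D` of the image has entries in `𝒜`, so pairing with `D` does not see the
expectation: `-tr (D* D) = tr (M D) ≥ 0`, whence `D = 0`. -/
theorem isCP_condExp : IsCP (condExp 𝒜) := fun k M hM => by
  have hsa : IsSelfAdjoint (M.map (condExp 𝒜)) := by
    refine CStarMatrix.ext fun i j => ?_
    have h : star (M j i) = M i j := congr_fun (congr_fun (IsSelfAdjoint.of_nonneg hM).star_eq i) j
    rw [CStarMatrix.star_apply, CStarMatrix.map_apply, CStarMatrix.map_apply, ← h,
      Matrix.star_eq_conjTranspose, Matrix.star_eq_conjTranspose, condExp_conjTranspose]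
  obtain ⟨D, hD, hD0, hmul, himp⟩ := exists_negPart_mem (isClosed_blockSubalgebra 𝒜 k)
    (show M.map (condExp 𝒜) ∈ blockSubalgebra 𝒜 k from fun i j => condExp_mem 𝒜 _) hsa
  refine himp (eq_zero_of_blockTrace_star_mul_self
    (le_antisymm ?_ (blockTrace_star_mul_self_nonneg D)))
  have h1 : blockTrace (M.map (condExp 𝒜) * D) = blockTrace (M * D) := by
    rw [blockTrace_mul, blockTrace_mul]
    exact Finset.sum_congr rfl fun i _ => Finset.sum_congr rfl fun j _ =>
      trace_condExp_mul _ (hD j i)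
  have h2 : blockTrace (-(star D * D)) = -blockTrace (star D * D) := by
    simp [blockTrace, Matrix.trace_neg]
  have h3 := blockTrace_mul_nonneg hM hD0
  rw [← h1, hmul, h2] at h3
  exact neg_nonneg.1 h3

end ConditionalExpectation

/-! ### Kadison–Schwarz inequality -/

section Schwarz

open scoped ComplexOrder

variable {n : Type*} [Fintype n] [DecidableEq n]

theorem traceDual_conjTranspose {R : Matrix n n ℂ →ₗ[ℂ] Matrix n n ℂ}
    (hR : ∀ X, R Xᴴ = (R X)ᴴ) (A : Matrix n n ℂ) : traceDual R Aᴴ = (traceDual R A)ᴴ := by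
  refine eq_of_trace_mul_eq ⊤ trivial trivial fun C _ => ?_
  rw [Matrix.trace_mul_comm, ← trace_mul_traceDual, ← star_inj, ← Matrix.trace_conjTranspose,
    ← Matrix.trace_conjTranspose, Matrix.conjTranspose_mul, Matrix.conjTranspose_mul, ← hR,
    Matrix.conjTranspose_conjTranspose, Matrix.conjTranspose_conjTranspose, Matrix.trace_mul_comm,
    trace_mul_traceDual]

/-- The Kadison–Schwarz inequality for the dual of a channel, tested against `K* K`. -/
theorem IsChannel.trace_schwarz {R : Matrix n n ℂ →ₗ[ℂ] Matrix n n ℂ} (hR : IsChannel R)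
    (K A : Matrix n n ℂ) :
    (Kᴴ * K * ((traceDual R A)ᴴ * traceDual R A)).trace ≤
      (Kᴴ * K * traceDual R (Aᴴ * A)).trace := by
  set B := traceDual R A with hB
  -- Pair the image under `R` of the square of the row `(K, -K B*)` with the square of the row `(A,
  -- 1)`. Trace preservation makes the `(2,2)` term cancel one cross term.
  let C : CStarMatrix (Fin 2) (Fin 2) (Matrix n n ℂ) :=
    CStarMatrix.ofMatrix !![K, -(K * Bᴴ); 0, 0]
  let D : CStarMatrix (Fin 2) (Fin 2) (Matrix n n ℂ) := CStarMatrix.ofMatrix !![A, 1; 0, 0]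
  have h := blockTrace_mul_nonneg (hR.isCP 2 _ (star_mul_self_nonneg C)) (star_mul_self_nonneg D)
  have hBs : Bᴴ = traceDual R Aᴴ := (traceDual_conjTranspose hR.map_conjTranspose A).symm
  rw [blockTrace_mul] at h
  simp [C, D, CStarMatrix.mul_apply, CStarMatrix.star_apply, Fin.sum_univ_two,
    Matrix.star_eq_conjTranspose] at h
  rw [trace_mul_traceDual, trace_mul_traceDual, trace_mul_traceDual, hR.tracePreserving, ← hBs,
    ← hB] at h
  have h1 : (B * Kᴴ * (K * Bᴴ)).trace = (B * Kᴴ * K * Bᴴ).trace := by simp only [mul_assoc]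
  have h2 : (Kᴴ * (K * Bᴴ) * B).trace = (Kᴴ * K * (Bᴴ * B)).trace := by simp only [mul_assoc]
  rw [h1, neg_add_cancel, add_zero, h2, ← sub_eq_add_neg] at h
  exact sub_nonneg.1 h

end Schwarz

/-! ### Pseudo-inverse square root -/

section PseudoInverse

variable {n : Type*} [Fintype n] [DecidableEq n]

theorem exists_sqrt_pseudoInverse {S : Matrix n n ℂ} (hS : 0 ≤ S) :
    ∃ Q : Matrix n n ℂ, Qᴴ = Q ∧ (∀ A, Commute A S → Commute A Q) ∧ S * (Q * Q) * S = S := by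
  have hsa : IsSelfAdjoint S := IsSelfAdjoint.of_nonneg hS
  have hc (f : ℝ → ℝ) : ContinuousOn f (spectrum ℝ S) :=
    Matrix.finite_real_spectrum.continuousOn f
  -- Since `0⁻¹ = 0`, this inverts `√S` on the range of `S` and vanishes on its kernel.
  refine ⟨cfc (fun x : ℝ => (√x)⁻¹) S, cfc_predicate (R := ℝ) (p := IsSelfAdjoint) _ S,
    fun A hA => ?_, ?_⟩
  · exact (hsa.commute_cfc hA.symm _).symm
  · rw [← cfc_mul _ _ S (hc _) (hc _)]
    nth_rw 1 [← cfc_id' ℝ S]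
    rw [← cfc_mul _ _ S (hc _) (hc _)]
    nth_rw 2 [← cfc_id' ℝ S]
    rw [← cfc_mul _ _ S (hc _) (hc _)]
    nth_rw 2 [← cfc_id' ℝ S]
    refine cfc_congr fun x hx => ?_
    have hx0 : 0 ≤ x := spectrum_nonneg_of_nonneg hS hx
    rw [← mul_inv, Real.mul_self_sqrt hx0]
    exact mul_inv_mul_cancel x

end PseudoInverse

/-! ### Kraus operators and the commutant of the `Kₖ* Kₗ` -/

section Kraus

open scoped ComplexOrder

variable {n c : Type*} [Fintype n]

/-- The Kraus operators of `ρ ↦ tr_c (V ρ V*)`. -/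
def blockRow (V : Matrix (n × c) n ℂ) (k : c) : Matrix n n ℂ := Matrix.of fun i j => V (i, k) j

theorem partialTraceSys_apply (V : Matrix (n × c) n ℂ) (X : Matrix n n ℂ) (k l : c) :
    partialTraceSys (V * X * Vᴴ) k l = (blockRow V k * X * (blockRow V l)ᴴ).trace := by
  simp [partialTraceSys, blockRow, Matrix.trace, Matrix.mul_apply]

variable [DecidableEq n]

/-- The commutant of the operators `Kₖ* Kₗ`. -/
def krausCommutant (K : c → Matrix n n ℂ) : StarSubalgebra ℂ (Matrix n n ℂ) :=
  StarSubalgebra.centralizer ℂ {X | ∃ k l, X = (K k)ᴴ * K l}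

theorem mem_krausCommutant {K : c → Matrix n n ℂ} {A : Matrix n n ℂ} :
    A ∈ krausCommutant K ↔ ∀ k l, (K k)ᴴ * K l * A = A * ((K k)ᴴ * K l) := by
  rw [krausCommutant, StarSubalgebra.mem_centralizer_iff]
  refine ⟨fun h k l => (h _ ⟨k, l, rfl⟩).1, ?_⟩
  rintro h _ ⟨k, l, rfl⟩
  refine ⟨h k l, ?_⟩
  rw [Matrix.star_eq_conjTranspose, Matrix.conjTranspose_mul, Matrix.conjTranspose_conjTranspose]
  exact h l k

theorem kerPerpCommutant_eq_krausCommutant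
    {K : c → Matrix n n ℂ} {Ψ : Matrix n n ℂ →ₗ[ℂ] Matrix c c ℂ}
    (hΨ : ∀ X k l, Ψ X k l = (K k * X * (K l)ᴴ).trace) :
    kerPerpCommutant Ψ = krausCommutant K := by
  have hker (X : Matrix n n ℂ) : X ∈ LinearMap.ker Ψ ↔ ∀ k l, (Xᴴ * ((K k)ᴴ * K l)).trace = 0 := by
    rw [LinearMap.mem_ker, ← Matrix.ext_iff]
    refine forall_congr' fun k => forall_congr' fun l => ?_
    rw [Matrix.zero_apply, hΨ, ← star_eq_zero (x := (Xᴴ * ((K k)ᴴ * K l)).trace),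
      ← Matrix.trace_conjTranspose, Matrix.conjTranspose_mul, Matrix.conjTranspose_mul, Matrix.conjTranspose_conjTranspose, Matrix.trace_mul_comm,
      Matrix.conjTranspose_conjTranspose, mul_assoc, Matrix.trace_mul_comm, mul_assoc]
  ext A
  rw [SetLike.mem_coe, mem_krausCommutant]
  constructor
  · intro h k l
    exact h _ fun X hX => (hker X).1 hX k l
  · intro h Y hY
    refine eq_of_trace_mul_eq ⊤ trivial trivial fun Z _ => ?_
    -- For every `Z` this adjoint commutator lies in the kernel, so `Y` is orthogonal to it, that
    -- is, `tr (Z (A Y - Y A)) = 0`. No double orthogonal complement is needed.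
    have hmem : (Z * A - A * Z)ᴴ ∈ LinearMap.ker Ψ := by
      rw [hker]
      intro k l
      rw [Matrix.conjTranspose_conjTranspose, sub_mul, Matrix.trace_sub, mul_assoc, ← h k l,
        mul_assoc A, Matrix.trace_mul_comm A, mul_assoc, mul_assoc, mul_assoc, sub_self]
    have := hY _ hmem
    rw [Matrix.conjTranspose_conjTranspose, sub_mul, Matrix.trace_sub] at this
    rw [mul_assoc, Matrix.trace_mul_comm Y, Matrix.trace_mul_comm _ Z, ← mul_assoc Z]
    exact (sub_eq_zero.1 this).symm

variable [Fintype c]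

/-- The map `X ↦ ∑ₖ Kₖ X Kₖ*`. -/
noncomputable def krausMap (K : c → Matrix n n ℂ) : Matrix n n ℂ →ₗ[ℂ] Matrix n n ℂ :=
  ∑ k, conjMap (K k)

@[simp]
theorem krausMap_apply (K : c → Matrix n n ℂ) (X : Matrix n n ℂ) :
    krausMap K X = ∑ k, K k * X * (K k)ᴴ := by
  simp [krausMap]

theorem isCP_krausMap (K : c → Matrix n n ℂ) : IsCP (krausMap K) :=
  IsCP.sum _ fun k => isCP_conjMap (K k)

theorem trace_krausMap_mul (K : c → Matrix n n ℂ) (X Y : Matrix n n ℂ) :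
    (krausMap K X * Y).trace = (X * ∑ k, (K k)ᴴ * Y * K k).trace := by
  rw [krausMap_apply, Finset.sum_mul, Finset.mul_sum, Matrix.trace_sum, Matrix.trace_sum]
  refine Finset.sum_congr rfl fun k _ => ?_
  rw [mul_assoc, mul_assoc, Matrix.trace_mul_comm]
  simp only [mul_assoc]

theorem trace_krausMap {K : c → Matrix n n ℂ} (hK : ∑ k, (K k)ᴴ * K k = 1) (X : Matrix n n ℂ) :
    (krausMap K X).trace = X.trace := by
  simpa [hK] using trace_krausMap_mul K X 1

theorem krausMap_one_nonneg (K : c → Matrix n n ℂ) : 0 ≤ krausMap K 1 := by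
  rw [krausMap_apply]
  refine Finset.sum_nonneg fun k _ => ?_
  rw [mul_one]
  exact mul_star_self_nonneg (K k)

/-- If `P` fixes `∑ₖ Kₖ Kₖ*` then it fixes every `Kₖ`. -/
theorem mul_kraus_eq_self {K : c → Matrix n n ℂ} {P : Matrix n n ℂ}
    (h : P * krausMap K 1 = krausMap K 1) (k : c) : P * K k = K k := by
  -- The sum is the trace of `(P - 1) Φ(1) (P - 1)*`, which vanishes, and its terms are nonnegative.
  have h0 : ∑ k, ((P - 1) * K k * ((P - 1) * K k)ᴴ).trace = 0 := by
    rw [← Matrix.trace_sum]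
    have : ∑ k, (P - 1) * K k * ((P - 1) * K k)ᴴ =
        (P - 1) * krausMap K 1 * (P - 1)ᴴ := by
      simp only [krausMap_apply, Matrix.conjTranspose_mul, mul_one, Finset.mul_sum, Finset.sum_mul,
        mul_assoc]
    rw [this, sub_mul, h, one_mul, sub_self, zero_mul, Matrix.trace_zero]
  rw [Finset.sum_eq_zero_iff_of_nonneg fun k _ =>
    (Matrix.posSemidef_self_mul_conjTranspose _).trace_nonneg] at h0
  have := Matrix.trace_mul_conjTranspose_self_eq_zero_iff.1 (h0 k (Finset.mem_univ _))
  rwa [sub_mul, one_mul, sub_eq_zero] at this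

/-! ### The intertwining representation -/

section Representation

variable {K : c → Matrix n n ℂ} {A : Matrix n n ℂ}

/-- In `∑ Kₖ A Kₖ* Kₗ` the factor `A` moves past `Kₖ* Kₗ`. -/
theorem krausMap_mul_kraus (hA : A ∈ krausCommutant K) (l : c) :
    krausMap K A * K l = krausMap K 1 * (K l * A) := by
  simp only [krausMap_apply, Finset.sum_mul, mul_one]
  refine Finset.sum_congr rfl fun k _ => ?_
  have := mem_krausCommutant.1 hA k l
  rw [mul_assoc, mul_assoc, ← this]
  simp only [mul_assoc]

theorem krausMap_commute_one (hA : A ∈ krausCommutant K) :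
    Commute (krausMap K A) (krausMap K 1) := by
  have h : krausMap K A * krausMap K 1 = ∑ l, krausMap K A * K l * (K l)ᴴ := by
    rw [krausMap_apply K 1, Finset.mul_sum]
    simp only [mul_one, mul_assoc]
  rw [Commute, SemiconjBy, h]
  simp_rw [krausMap_mul_kraus hA]
  rw [krausMap_apply K A, Finset.mul_sum]
  simp only [mul_assoc]

theorem krausMap_conjTranspose (K : c → Matrix n n ℂ) (A : Matrix n n ℂ) :
    krausMap K Aᴴ = (krausMap K A)ᴴ := by
  simp [Matrix.conjTranspose_sum, mul_assoc]

/-- The operators `Kₖ` of a Kraus family intertwine a representation of the commutant of the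
`Kₖ* Kₗ`. -/
theorem exists_representation (K : c → Matrix n n ℂ) :
    ∃ (Q : Matrix n n ℂ) (π : krausCommutant K →⋆ₙₐ[ℂ] Matrix n n ℂ), Qᴴ = Q ∧
      (1 - Q * krausMap K 1 * Q) * (1 - Q * krausMap K 1 * Q) = 1 - Q * krausMap K 1 * Q ∧
      (∀ k, Q * krausMap K 1 * Q * K k = K k) ∧
      (∀ A, π A = Q * krausMap K A * Q) ∧
      (∀ A k, π A * K k = K k * A) ∧ ∀ A k, (K k)ᴴ * π A = A * (K k)ᴴ := by
  obtain ⟨Q, hQ, hcomm, hSQ⟩ := exists_sqrt_pseudoInverse (krausMap_one_nonneg K)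
  have hS : Q * krausMap K 1 = krausMap K 1 * Q := (hcomm _ (Commute.refl _)).symm
  -- `Q Φ(1) Q` is the support projection of `Φ(1)`.
  have hP (k : c) : Q * krausMap K 1 * Q * K k = K k := by
    refine mul_kraus_eq_self ?_ k
    rw [hS, mul_assoc (krausMap K 1)]
    exact hSQ
  have hPP : Q * krausMap K 1 * Q * (Q * krausMap K 1 * Q) = Q * krausMap K 1 * Q := by
    calc _ = Q * (krausMap K 1 * (Q * Q) * krausMap K 1) * Q := by simp only [mul_assoc]
      _ = _ := by rw [hSQ]
  have hc (A : krausCommutant K) : Commute (krausMap K A) Q :=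
    hcomm _ (krausMap_commute_one A.2)
  have hleft (A : krausCommutant K) (k : c) : Q * krausMap K A * Q * K k = K k * A := by
    rw [mul_assoc Q, (hc A).eq, mul_assoc, mul_assoc, krausMap_mul_kraus A.2]
    calc _ = Q * (Q * krausMap K 1) * (K k * A) := by simp only [mul_assoc]
      _ = Q * krausMap K 1 * Q * K k * A := by rw [mul_assoc Q _ Q, ← hS, ← mul_assoc]
      _ = _ := by rw [hP]
  have hstar (A : krausCommutant K) :
      Q * krausMap K (A : Matrix n n ℂ)ᴴ * Q = (Q * krausMap K A * Q)ᴴ := by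
    rw [krausMap_conjTranspose, Matrix.conjTranspose_mul, Matrix.conjTranspose_mul, hQ, mul_assoc]
  let π : krausCommutant K →⋆ₙₐ[ℂ] Matrix n n ℂ :=
    { toFun := fun A => Q * krausMap K A * Q
      map_smul' := fun a A => by
        change Q * krausMap K (a • (A : Matrix n n ℂ)) * Q = a • (Q * krausMap K A * Q)
        rw [map_smul, mul_smul_comm, smul_mul_assoc]
      map_zero' := by simp
      map_add' := fun A B => by
        change Q * krausMap K (A + B : Matrix n n ℂ) * Q = _
        rw [map_add, mul_add, add_mul]
      map_mul' := fun A B => by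
        -- Intertwining moves `A` inside the Kraus sum; compressing by `Q` then gives
        -- multiplicativity.
        have h : Q * krausMap K A * Q * krausMap K B = krausMap K (A * B : Matrix n n ℂ) := by
          rw [krausMap_apply K B, krausMap_apply K (A * B), Finset.mul_sum]
          refine Finset.sum_congr rfl fun k _ => ?_
          rw [← mul_assoc, ← mul_assoc, hleft]
          simp only [mul_assoc]
        have hq : Commute (Q * krausMap K A * Q) Q :=
          ((Commute.refl Q).mul_left (hc A)).mul_left (Commute.refl Q)
        calc Q * krausMap K (A * B : Matrix n n ℂ) * Q
            = Q * (Q * krausMap K A * Q) * (krausMap K B * Q) := by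
              rw [← h]; simp only [mul_assoc]
          _ = Q * krausMap K A * Q * (Q * krausMap K B * Q) := by
              rw [← hq.eq]; simp only [mul_assoc]
      map_star' := fun A => hstar A }
  refine ⟨Q, π, hQ, ?_, hP, fun _ => rfl, hleft, fun A k => ?_⟩
  · rw [sub_mul, one_mul, mul_sub, mul_one, hPP, sub_self, sub_zero]
  · have h := congrArg Matrix.conjTranspose (hleft (star A) k)
    have hs : (Q * krausMap K (star A : krausCommutant K) * Q) = (π A)ᴴ := hstar A
    rw [hs, Matrix.conjTranspose_mul, Matrix.conjTranspose_mul] at h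
    simpa [Matrix.star_eq_conjTranspose] using h

end Representation

/-! ### Correctable algebras -/

section Correctable

variable {K : c → Matrix n n ℂ} {𝒜 : StarSubalgebra ℂ (Matrix n n ℂ)}

theorem isCorrectable_of_le_krausCommutant (hK : ∑ k, (K k)ᴴ * K k = 1)
    (h𝒜 : 𝒜 ≤ krausCommutant K) : IsCorrectable (krausMap K) 𝒜 := by
  obtain ⟨Q, π, hQ, hPP, hP, hπ, hleft, hright⟩ := exists_representation K
  set P := Q * krausMap K 1 * Q with hPdef
  have hPs : (1 - P)ᴴ = 1 - P := by
    rw [hPdef, Matrix.conjTranspose_sub, Matrix.conjTranspose_mul, Matrix.conjTranspose_mul, hQ,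
      ← krausMap_conjTranspose]
    simp [mul_assoc]
  have hP0 (X : Matrix n n ℂ) : conjMap (1 - P) (krausMap K X) = 0 := by
    have h : P * krausMap K X = krausMap K X := by
      simp only [krausMap_apply, Finset.mul_sum, ← mul_assoc, hP]
    rw [conjMap_apply, sub_mul, h, one_mul, sub_self, zero_mul]
  -- The first summand has dual `Y ↦ Q Φ(Y) Q` and scales the trace to `tr (X P)`. The second
  -- restores trace preservation and vanishes on the range of `Φ`.
  let R₀ : Matrix n n ℂ →ₗ[ℂ] Matrix n n ℂ :=
    krausMap (fun k => (K k)ᴴ) ∘ₗ conjMap Q + depolarizing n ∘ₗ conjMap (1 - P)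
  have hR₀ : IsCP R₀ := ((isCP_krausMap _).comp (isCP_conjMap Q)).add
    (isCP_depolarizing.comp (isCP_conjMap _))
  have hdual (X Y : Matrix n n ℂ) :
      (krausMap (fun k => (K k)ᴴ) (conjMap Q X) * Y).trace =
        (X * (Q * krausMap K Y * Q)).trace := by
    rw [trace_krausMap_mul]
    simp only [Matrix.conjTranspose_conjTranspose, ← krausMap_apply]
    rw [conjMap_apply, hQ, mul_assoc, mul_assoc, Matrix.trace_mul_comm]
    simp only [mul_assoc]
  refine ⟨condExp 𝒜 ∘ₗ R₀, ((isCP_condExp 𝒜).comp hR₀).isChannel fun X => ?_,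
    fun X => condExp_mem 𝒜 _, fun A hA => ?_⟩
  · have h1 := hdual X 1
    rw [mul_one, ← hPdef] at h1
    rw [LinearMap.comp_apply, trace_condExp, LinearMap.add_apply, Matrix.trace_add,
      LinearMap.comp_apply, LinearMap.comp_apply, h1, trace_depolarizing, conjMap_apply, hPs,
      Matrix.trace_mul_comm (_ * _), ← mul_assoc (1 - P), hPP, Matrix.trace_mul_comm _ X, mul_sub,
      mul_one, Matrix.trace_sub, add_sub_cancel]
  · refine eq_of_trace_mul_eq ⊤ trivial trivial fun X _ => ?_
    rw [Matrix.trace_mul_comm, ← trace_mul_traceDual, ← trace_mul_traceDual, LinearMap.comp_apply,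
      trace_condExp_mul _ hA, LinearMap.add_apply, LinearMap.comp_apply, LinearMap.comp_apply, hP0,
      map_zero, add_zero, hdual, ← hπ ⟨A, h𝒜 hA⟩, Matrix.trace_mul_comm A,
      ← trace_krausMap hK (X * A)]
    congr 1
    rw [krausMap_apply, krausMap_apply, Finset.sum_mul]
    refine Finset.sum_congr rfl fun k _ => ?_
    rw [mul_assoc, hright]
    simp only [mul_assoc]

/-- Since `Φ† R†` fixes both `A` and `A* A`, the Schwarz inequality for `R†` is saturated after
applying `Φ†` and taking the trace. -/
theorem le_krausCommutant_of_isCorrectable (hK : ∑ k, (K k)ᴴ * K k = 1)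
    (h : IsCorrectable (krausMap K) 𝒜) : 𝒜 ≤ krausCommutant K := by
  obtain ⟨R, hR, -, hRA⟩ := h
  have hdual (X : Matrix n n ℂ) : traceDual (krausMap K) X = ∑ k, (K k)ᴴ * X * K k := by
    refine eq_of_trace_mul_eq ⊤ trivial trivial fun C _ => ?_
    rw [Matrix.trace_mul_comm, ← trace_mul_traceDual, trace_krausMap_mul, Matrix.trace_mul_comm]
  have key (A : Matrix n n ℂ) (hA : A ∈ 𝒜) (k : c) : traceDual R A * K k = K k * A := by
    set B := traceDual R A with hB
    have hfix (A : Matrix n n ℂ) (hA : A ∈ 𝒜) : ∑ k, (K k)ᴴ * traceDual R A * K k = A := by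
      rw [← hdual, hRA A hA]
    have h1 : ∑ k, (K k)ᴴ * B * K k = A := hfix A hA
    have h2 : ∑ k, (K k)ᴴ * Bᴴ * K k = Aᴴ := by
      rw [hB, ← traceDual_conjTranspose hR.map_conjTranspose]
      exact hfix _ (star_mem hA)
    have h3 : ∑ k, (K k)ᴴ * traceDual R (Aᴴ * A) * K k = Aᴴ * A :=
      hfix _ (mul_mem (star_mem hA) hA)
    have h4 : ∑ k, ((K k)ᴴ * (Bᴴ * B) * K k).trace ≤ (Aᴴ * A).trace := by
      rw [← h3, Matrix.trace_sum]
      refine Finset.sum_le_sum fun k _ => ?_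
      have := hR.trace_schwarz (K k)ᴴ A
      rw [Matrix.conjTranspose_conjTranspose] at this
      have hcycle (X : Matrix n n ℂ) : ((K k)ᴴ * X * K k).trace = (K k * (K k)ᴴ * X).trace := by
        rw [Matrix.trace_mul_comm, mul_assoc]
      rwa [hcycle, hcycle]
    -- Expanding the square, `h1`, `h2` and `hK` turn the two cross terms and the last term into `-1
    -- - 1 + 1` copies of `tr (A* A)`.
    have h5 : ∑ k, ((B * K k - K k * A)ᴴ * (B * K k - K k * A)).trace =
        ∑ k, ((K k)ᴴ * (Bᴴ * B) * K k).trace - (Aᴴ * A).trace := by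
      rw [← Matrix.trace_sum, ← Matrix.trace_sum, ← Matrix.trace_sub]
      congr 1
      have (k : c) : (B * K k - K k * A)ᴴ * (B * K k - K k * A) =
          (K k)ᴴ * (Bᴴ * B) * K k - (K k)ᴴ * Bᴴ * K k * A - Aᴴ * ((K k)ᴴ * B * K k) +
            Aᴴ * ((K k)ᴴ * K k) * A := by
        rw [Matrix.conjTranspose_sub, Matrix.conjTranspose_mul, Matrix.conjTranspose_mul]
        noncomm_ring
      simp_rw [this]
      rw [Finset.sum_add_distrib, Finset.sum_sub_distrib, Finset.sum_sub_distrib, ← Finset.sum_mul,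
        ← Finset.mul_sum, ← Finset.sum_mul, ← Finset.mul_sum, h1, h2, hK, mul_one, sub_add_cancel]
    have h6 : ∑ k, ((B * K k - K k * A)ᴴ * (B * K k - K k * A)).trace = 0 :=
      le_antisymm (h5 ▸ sub_nonpos.2 h4) (Finset.sum_nonneg fun k _ =>
        trace_conjTranspose_mul_self_nonneg _)
    rw [Finset.sum_eq_zero_iff_of_nonneg fun k _ => trace_conjTranspose_mul_self_nonneg _] at h6
    exact sub_eq_zero.1 (Matrix.trace_conjTranspose_mul_self_eq_zero_iff.1
      (h6 k (Finset.mem_univ _)))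
  intro A hA
  rw [mem_krausCommutant]
  intro k l
  have h := congrArg Matrix.conjTranspose (key _ (star_mem hA) k)
  rw [Matrix.star_eq_conjTranspose, traceDual_conjTranspose hR.map_conjTranspose,
    Matrix.conjTranspose_mul, Matrix.conjTranspose_mul, Matrix.conjTranspose_conjTranspose,
    Matrix.conjTranspose_conjTranspose] at h
  rw [mul_assoc, ← key A hA l, ← mul_assoc, h, mul_assoc]

end Correctable

/-! ### The complementary map -/

section Complementary

variable {K : c → Matrix n n ℂ} {Ψ : Matrix n n ℂ →ₗ[ℂ] Matrix c c ℂ}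

/-- `Ψ†(Y)` is a combination of the `Kₗ* Kₖ` with the entries of `Y` as coefficients; matrix units
isolate each product. -/
theorem isPrivate_iff_le_krausCommutant (hΨ : ∀ X k l, Ψ X k l = (K k * X * (K l)ᴴ).trace)
    {𝒜 : StarSubalgebra ℂ (Matrix n n ℂ)} : IsPrivate Ψ 𝒜 ↔ 𝒜 ≤ krausCommutant K := by
  classical
  have hdual (Y : Matrix c c ℂ) :
      traceDual Ψ Y = ∑ k, ∑ l, Y l k • ((K l)ᴴ * K k) := by
    refine eq_of_trace_mul_eq ⊤ trivial trivial fun X _ => ?_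
    rw [Matrix.trace_mul_comm, ← trace_mul_traceDual, Finset.sum_mul, Matrix.trace_sum,
      Matrix.trace]
    refine Finset.sum_congr rfl fun k _ => ?_
    rw [Matrix.diag_apply, Matrix.mul_apply, Finset.sum_mul, Matrix.trace_sum]
    refine Finset.sum_congr rfl fun l _ => ?_
    rw [hΨ, smul_mul_assoc, Matrix.trace_smul, smul_eq_mul, mul_comm, Matrix.trace_mul_comm,
      ← mul_assoc]
  constructor
  · intro h A hA
    rw [mem_krausCommutant]
    intro k l
    have := h (Matrix.single k l 1) A hA
    have hs : traceDual Ψ (Matrix.single k l 1) = (K k)ᴴ * K l := by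
      rw [hdual, Finset.sum_eq_single l, Finset.sum_eq_single k]
      · simp
      · intro b _ hb
        simp [hb.symm]
      · simp
      · intro b _ hb
        simp [hb.symm]
      · simp
    rw [hs] at this
    exact this.symm
  · intro h Y A hA
    rw [hdual, Finset.mul_sum, Finset.sum_mul]
    refine Finset.sum_congr rfl fun k _ => ?_
    rw [Finset.mul_sum, Finset.sum_mul]
    refine Finset.sum_congr rfl fun l _ => ?_
    rw [mul_smul_comm, smul_mul_assoc, mem_krausCommutant.1 (h hA)]

theorem partialTraceEnv_eq_krausMap (V : Matrix (n × c) n ℂ) (X : Matrix n n ℂ) :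
    partialTraceEnv (V * X * Vᴴ) = krausMap (blockRow V) X := by
  ext i j
  simp [partialTraceEnv, blockRow, Matrix.sum_apply, Matrix.mul_apply]

theorem sum_blockRow {V : Matrix (n × c) n ℂ} (hV : Vᴴ * V = 1) :
    ∑ k, (blockRow V k)ᴴ * blockRow V k = 1 := by
  rw [← hV]
  ext i j
  simp [blockRow, Matrix.sum_apply, Matrix.mul_apply, Fintype.sum_prod_type_right]

end Complementary

theorem genMultDomain_subset {Φ : Matrix n n ℂ →ₗ[ℂ] Matrix n n ℂ}
    {𝒜 : StarSubalgebra ℂ (Matrix n n ℂ)} (π : 𝒜 →⋆ₙₐ[ℂ] Matrix n n ℂ) :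
    genMultDomain Φ 𝒜 π ⊆ 𝒜 := fun _ ⟨hA, _⟩ => hA

/-- The relations hold for each Kraus term separately, so they also pass to restrictions of `π`. -/
theorem isAssociated_of_intertwines {K : c → Matrix n n ℂ}
    {𝒜 : StarSubalgebra ℂ (Matrix n n ℂ)} {π : 𝒜 →⋆ₙₐ[ℂ] Matrix n n ℂ}
    (hleft : ∀ A k, π A * K k = K k * A) (hright : ∀ A k, (K k)ᴴ * π A = A * (K k)ᴴ) :
    IsAssociated (krausMap K) 𝒜 π := by
  refine Set.Subset.antisymm (fun A hA => ⟨hA, fun X => ?_⟩) (genMultDomain_subset π)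
  simp only [krausMap_apply, Finset.mul_sum, Finset.sum_mul]
  constructor
  · refine Finset.sum_congr rfl fun k _ => ?_
    rw [← mul_assoc, ← mul_assoc, ← mul_assoc, hleft ⟨A, hA⟩]
  · refine Finset.sum_congr rfl fun k _ => ?_
    rw [mul_assoc _ _ (π _), hright ⟨A, hA⟩]
    simp only [mul_assoc]

end Kraus

end QChannel

theorem mainTheorem4 {n c : Type*} [Fintype n] [DecidableEq n] [Fintype c]
    (Φ : Matrix n n ℂ →ₗ[ℂ] Matrix n n ℂ) (hΦ : QChannel.IsChannel Φ)
    (ΦC : Matrix n n ℂ →ₗ[ℂ] Matrix c c ℂ) (hΦC : QChannel.IsComplementary Φ ΦC) :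
    (∀ 𝒜 : StarSubalgebra ℂ (Matrix n n ℂ),
      QChannel.IsCorrectable Φ 𝒜 ↔ QChannel.IsPrivate ΦC 𝒜) ∧
    (∀ 𝒜 : StarSubalgebra ℂ (Matrix n n ℂ), QChannel.IsCorrectable Φ 𝒜 →
      ∀ π : 𝒜 →⋆ₙₐ[ℂ] Matrix n n ℂ, QChannel.IsAssociated Φ 𝒜 π →
        QChannel.genMultDomain Φ 𝒜 π ⊆ QChannel.kerPerpCommutant ΦC ∧
        (QChannel.genMultDomain Φ 𝒜 π = QChannel.kerPerpCommutant ΦC ↔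
          Maximal (QChannel.IsCorrectable Φ) 𝒜)) ∧
    (∃ (𝒩 : StarSubalgebra ℂ (Matrix n n ℂ)) (ϖ : 𝒩 →⋆ₙₐ[ℂ] Matrix n n ℂ),
      QChannel.IsCorrectable Φ 𝒩 ∧ QChannel.IsAssociated Φ 𝒩 ϖ ∧
      QChannel.genMultDomain Φ 𝒩 ϖ = QChannel.kerPerpCommutant ΦC ∧
      ∀ 𝒜 : StarSubalgebra ℂ (Matrix n n ℂ), QChannel.IsCorrectable Φ 𝒜 →
        ∃ h : 𝒜 ≤ 𝒩, QChannel.IsAssociated Φ 𝒜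
          (ϖ.comp (StarSubalgebra.inclusion h).toNonUnitalStarAlgHom)) := by
  obtain ⟨V, hV, hΦV, hΦCV⟩ := hΦC
  set K := QChannel.blockRow V
  have hK : ∑ k, (K k)ᴴ * K k = 1 := QChannel.sum_blockRow hV
  obtain rfl : Φ = QChannel.krausMap K := LinearMap.ext fun X =>
    (hΦV X).trans (QChannel.partialTraceEnv_eq_krausMap V X)
  have hΨ (X : Matrix n n ℂ) (k l : c) : ΦC X k l = (K k * X * (K l)ᴴ).trace := by
    rw [hΦCV, QChannel.partialTraceSys_apply]
  have hcorr (𝒜 : StarSubalgebra ℂ (Matrix n n ℂ)) :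
      QChannel.IsCorrectable (QChannel.krausMap K) 𝒜 ↔ 𝒜 ≤ QChannel.krausCommutant K :=
    ⟨QChannel.le_krausCommutant_of_isCorrectable hK,
      QChannel.isCorrectable_of_le_krausCommutant hK⟩
  rw [QChannel.kerPerpCommutant_eq_krausCommutant hΨ]
  refine ⟨fun 𝒜 => (hcorr 𝒜).trans (QChannel.isPrivate_iff_le_krausCommutant hΨ).symm,
    fun 𝒜 h𝒜 π hπ => ?_, ?_⟩
  · rw [← show (𝒜 : Set (Matrix n n ℂ)) = _ from hπ]
    refine ⟨(hcorr 𝒜).1 h𝒜, fun h => ?_, fun h => ?_⟩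
    · obtain rfl := SetLike.coe_injective h
      exact ⟨h𝒜, fun ℬ hℬ _ => (hcorr ℬ).1 hℬ⟩
    -- The commutant is itself correctable and contains `𝒜`, so maximality forces equality.
    · exact Set.Subset.antisymm ((hcorr 𝒜).1 h𝒜)
        (h.2 ((hcorr _).2 le_rfl) ((hcorr 𝒜).1 h𝒜))
  · obtain ⟨Q, π, -, -, -, -, hleft, hright⟩ := QChannel.exists_representation K
    have hass := QChannel.isAssociated_of_intertwines hleft hright
    exact ⟨QChannel.krausCommutant K, π, (hcorr _).2 le_rfl, hass, hass.symm, fun 𝒜 h𝒜 =>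
      ⟨(hcorr 𝒜).1 h𝒜, QChannel.isAssociated_of_intertwines
        (fun A => hleft (StarSubalgebra.inclusion ((hcorr 𝒜).1 h𝒜) A))
        (fun A => hright (StarSubalgebra.inclusion ((hcorr 𝒜).1 h𝒜) A))⟩⟩
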